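/- There are absolute constants $C_1,C_2>0$ such that the following holds. Let $M\ge 1$ and $k\ge 2$ be integers, and let $F:\{0,1\}^M\to\{0,1\}$ be a Boolean function represented by a Zhegalkin polynomial $$F(x)=a\oplus\bigoplus_{i=1}^{k}C_i(x),\qquad C_i(x)=\bigwedge_{z=1}^{t_i}x_{j_{i,z}},$$ where $a\in\{0,1\}$, $t_1,\dots,t_k\ge 0$ are integers and $j_{i,z}\in\{1,\dots,M\}$ (an empty conjunction being $1$). Then there is a quantum query algorithm for $F$ that has running time at most $$C_1\sqrt{k\,(k+t_1+\dots+t_k)}\,\log k$$ and that, on every input $x\in\{0,1\}^M$, errs with probability at most $C_2/k$. That is, the running time is $O\big(\sqrt{k(k+t_1+\dots+t_k)}\,\log k\big)$ and the error probability is $O(1/k)$. Here running time means the number of queries to the input $x$ in the standard quantum query model: the algorithm starts in a fixed basis state $|i\rangle|z\rangle|w\rangle$ with $i\in\{1,\dots,M\}$, $z\in\{0,1\}$ and $w$ ranging over a finite work-space, alternates unitaries that do not depend on $x$ (but may depend on the polynomial) with the query unitary $|i\rangle|z\rangle|w\rangle\mapsto|i\rangle|z+x_i \bmod 2\rangle|w\rangle$,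 and obtains its output bit from a measurement at the end. -/

import Mathlib

/-- The computational basis `|i⟩|z⟩|w⟩` of the state space of a quantum query algorithm on `M` input
bits: `i` is the index of the queried variable, `z` is the output bit of the query, and `w` is the
content of the auxiliary work-space. The bits `0, 1` are the elements of `ZMod 2`. -/
abbrev QueryBasis (M : ℕ) (W : Type) : Type := Fin M × ZMod 2 × W

/-- The query unitary `|i⟩|z⟩|w⟩ ↦ |i⟩|z + x i (mod 2)⟩|w⟩` of the input `x`, as a matrix in the
computational basis. -/
def queryMatrix {M : ℕ} (W : Type) [DecidableEq W] (x : Fin M → ZMod 2) :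
    Matrix (QueryBasis M W) (QueryBasis M W) ℂ :=
  Matrix.of fun b' b => if b' = (b.1, b.2.1 + x b.1, b.2.2) then 1 else 0

/-- A quantum query algorithm on `M` input bits: a finite work-space, a number of queries, an initial
basis state, unitaries `U 0, …, U queries` that do not depend on the input, and a reading of the
outcome of the final measurement as an output bit. -/
structure QueryAlgorithm (M : ℕ) where
  /-- labels of the basis states of the auxiliary work-space -/
  W : Type
  [fintypeW : Fintype W]
  [decidableEqW : DecidableEq W]
  /-- the number of queries to the input -/
  queries : ℕ
  /-- the basis state in which the algorithm starts -/
  init : QueryBasis M W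
  /-- the unitaries applied between the queries; only `U 0, …, U queries` are used -/
  U : ℕ → Matrix.unitaryGroup (QueryBasis M W) ℂ
  /-- the output bit, as a function of the outcome of the final measurement -/
  out : QueryBasis M W → ZMod 2

namespace QueryAlgorithm

attribute [instance] QueryAlgorithm.fintypeW QueryAlgorithm.decidableEqW

/-- The state `U s · O_x · U (s-1) · O_x ⋯ O_x · U 0 |init⟩` after `s` queries to the input `x`. -/
noncomputable def state {M : ℕ} (Q : QueryAlgorithm M) (x : Fin M → ZMod 2) :
    ℕ → QueryBasis M Q.W → ℂ
  | 0 => (Q.U 0).1.mulVec (Pi.single Q.init 1)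
  | s + 1 => (Q.U (s + 1)).1.mulVec ((queryMatrix Q.W x).mulVec (Q.state x s))

/-- The probability that the final measurement, in the computational basis and after all queries to
the input `x`, gives the output `v`. -/
noncomputable def outputProb {M : ℕ} (Q : QueryAlgorithm M) (x : Fin M → ZMod 2) (v : ZMod 2) : ℝ :=
  ∑ b with Q.out b = v, ‖Q.state x Q.queries b‖ ^ 2

/-- The probability that the algorithm does not output `F x` on the input `x`. -/
noncomputable def errorProb {M : ℕ} (Q : QueryAlgorithm M) (F : (Fin M → ZMod 2) → ZMod 2)
    (x : Fin M → ZMod 2) : ℝ :=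
  ∑ v with v ≠ F x, Q.outputProb x v

end QueryAlgorithm

/-- The Zhegalkin polynomial `a ⊕ C₁ ⊕ ⋯ ⊕ C_k` with `C_i = ⋀_z x_{j i z}` a conjunction of `t i`
variables, at the point `x`. In `ZMod 2`, `⊕` is addition and `∧` is multiplication. -/
def zhegalkin {M k : ℕ} (a : ZMod 2) (t : Fin k → ℕ) (j : (i : Fin k) → Fin (t i) → Fin M)
    (x : Fin M → ZMod 2) : ZMod 2 :=
  a + ∑ i : Fin k, ∏ z : Fin (t i), x (j i z)

/-! A conjunction is `0` exactly when one of its variables is `0`, so it can be evaluated by Grover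
search for a zero. After `r` iterations the position found is queried and the answer is output. If
all variables are `1`, this is always right; otherwise it errs with probability `cos² ((2r+1)θ)`,
where `sin² θ` is the fraction of zeros (`outputProb_grover_one`).

The number of zeros is unknown, so runs with `2r+1 = 1, 3, 9, …` are made, up to order `√n` for `n`
variables. One of them has error at most `1/2` (`exists_cos_three_pow_mul_sq_le`). As errors are
one-sided, the product of all outputs inherits this bound, and the query counts form a geometric sum
`O(√n)` (`exists_isOneSided_half`).

Repeating this `O(log k)` times brings the error of each conjunction below `1/k²`. Adding the `k`
results costs a union bound, leaving `1/k`, and Cauchy–Schwarz bounds `∑ √tᵢ`. -/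

open scoped Kronecker

/-! ### Query and unitary matrices -/

lemma queryMatrix_mulVec {M : ℕ} {W : Type} [Fintype W] [DecidableEq W] (x : Fin M → ZMod 2)
    (v : QueryBasis M W → ℂ) (b : QueryBasis M W) :
    (queryMatrix W x).mulVec v b = v (b.1, b.2.1 + x b.1, b.2.2) := by
  have key : ∀ c : QueryBasis M W,
      b = (c.1, c.2.1 + x c.1, c.2.2) ↔ c = (b.1, b.2.1 + x b.1, b.2.2) := by
    obtain ⟨i, z, w⟩ := b
    rintro ⟨i', z', w'⟩
    simp only [Prod.mk.injEq]
    have h2 : ∀ u y : ZMod 2, u + y + y = u := by decide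
    constructor
    · rintro ⟨rfl, rfl, rfl⟩; simp [h2]
    · rintro ⟨rfl, rfl, rfl⟩; simp [h2]
  simp only [Matrix.mulVec, dotProduct, queryMatrix, Matrix.of_apply, key]
  simp

lemma sum_norm_sq_mulVec_unitary {α : Type} [Fintype α] [DecidableEq α]
    (U : Matrix.unitaryGroup α ℂ) (v : α → ℂ) :
    ∑ b, ‖U.1.mulVec v b‖ ^ 2 = ∑ b, ‖v b‖ ^ 2 := by
  have h : ∀ w : α → ℂ, ((∑ b, ‖w b‖ ^ 2 : ℝ) : ℂ) = star w ⬝ᵥ w := by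
    intro w
    simp [dotProduct, ← Complex.conj_mul']
  have hU : U.1.conjTranspose * U.1 = 1 := Matrix.mem_unitaryGroup_iff'.1 U.2
  apply Complex.ofReal_injective
  rw [h, h, Matrix.star_mulVec, Matrix.dotProduct_mulVec, Matrix.vecMul_vecMul, hU,
    Matrix.vecMul_one]

/-- Adding the queried bit to the answer register, as a permutation of the basis states. -/
def queryEquiv {M : ℕ} (W : Type) (x : Fin M → ZMod 2) : QueryBasis M W ≃ QueryBasis M W where
  toFun b := (b.1, b.2.1 + x b.1, b.2.2)
  invFun b := (b.1, b.2.1 - x b.1, b.2.2)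
  left_inv b := by simp
  right_inv b := by simp

/-- A unitary matrix, with rows and columns relabelled by two bijections. -/
def unitarySubmatrix {α β : Type} [Fintype α] [DecidableEq α] [Fintype β] [DecidableEq β]
    (A : Matrix.unitaryGroup α ℂ) (e e' : β ≃ α) : Matrix.unitaryGroup β ℂ :=
  ⟨A.1.submatrix e e', by
    rw [Matrix.mem_unitaryGroup_iff, Matrix.star_eq_conjTranspose, Matrix.conjTranspose_submatrix,
      Matrix.submatrix_mul_equiv, ← Matrix.star_eq_conjTranspose,
      Matrix.mem_unitaryGroup_iff.1 A.2, Matrix.submatrix_one_equiv]⟩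

/-- The tensor product of two unitary matrices. -/
def unitaryKronecker {α β : Type} [Fintype α] [DecidableEq α] [Fintype β] [DecidableEq β]
    (A : Matrix.unitaryGroup α ℂ) (B : Matrix.unitaryGroup β ℂ) :
    Matrix.unitaryGroup (α × β) ℂ :=
  ⟨A.1 ⊗ₖ B.1, Matrix.kronecker_mem_unitary A.2 B.2⟩

lemma unitarySubmatrix_kronecker_mulVec {α β γ : Type} [Fintype α] [DecidableEq α] [Fintype β]
    [DecidableEq β] [Fintype γ] [DecidableEq γ]
    (A : Matrix.unitaryGroup α ℂ) (B : Matrix.unitaryGroup β ℂ) (e e' : γ ≃ α × β)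
    (f : α → ℂ) (g : β → ℂ) :
    (unitarySubmatrix (unitaryKronecker A B) e e').1.mulVec
        (fun c => f (e' c).1 * g (e' c).2) =
      fun c => A.1.mulVec f (e c).1 * B.1.mulVec g (e c).2 := by
  funext c
  simp only [unitarySubmatrix, unitaryKronecker, Matrix.mulVec, dotProduct,
    Matrix.submatrix_apply, Matrix.kroneckerMap_apply]
  rw [Equiv.sum_comp e' (fun p : α × β => A.1 (e c).1 p.1 * B.1 (e c).2 p.2 * (f p.1 * g p.2)),
    Fintype.sum_prod_type, Finset.sum_mul_sum]
  refine Finset.sum_congr rfl fun i _ => Finset.sum_congr rfl fun j _ => ?_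
  ring

/-! ### Independent runs of two algorithms -/

namespace QueryAlgorithm

variable {M : ℕ}

lemma sum_norm_sq_state (Q : QueryAlgorithm M) (x : Fin M → ZMod 2) (s : ℕ) :
    ∑ b, ‖Q.state x s b‖ ^ 2 = 1 := by
  induction s with
  | zero =>
    rw [state, sum_norm_sq_mulVec_unitary, Finset.sum_eq_single Q.init]
    · simp
    · intro b _ hb; simp [hb]
    · simp
  | succ s ih =>
    rw [state, sum_norm_sq_mulVec_unitary, ← ih]
    simp only [queryMatrix_mulVec]
    exact Equiv.sum_comp (queryEquiv Q.W x) (fun b => ‖Q.state x s b‖ ^ 2)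

lemma outputProb_nonneg (Q : QueryAlgorithm M) (x : Fin M → ZMod 2) (v : ZMod 2) :
    0 ≤ Q.outputProb x v :=
  Finset.sum_nonneg fun _ _ => by positivity

lemma sum_outputProb (Q : QueryAlgorithm M) (x : Fin M → ZMod 2) :
    Q.outputProb x 0 + Q.outputProb x 1 = 1 := by
  rw [← Q.sum_norm_sq_state x Q.queries, ← Finset.sum_fiberwise Finset.univ Q.out]
  exact (Fin.sum_univ_two (Q.outputProb x)).symm

lemma errorProb_eq (Q : QueryAlgorithm M) (F : (Fin M → ZMod 2) → ZMod 2) (x : Fin M → ZMod 2) :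
    Q.errorProb F x = Q.outputProb x (F x + 1) := by
  have h : (Finset.univ.filter fun v : ZMod 2 => v ≠ F x) = {F x + 1} := by
    generalize F x = u
    revert u; decide
  rw [errorProb, h, Finset.sum_singleton]

/-- The state after `s` queries to the input `x`, for the unitaries `U` and the start `init`. -/
noncomputable def evolution {W : Type} [Fintype W] [DecidableEq W]
    (U : ℕ → Matrix.unitaryGroup (QueryBasis M W) ℂ) (init : QueryBasis M W)
    (x : Fin M → ZMod 2) : ℕ → QueryBasis M W → ℂ
  | 0 => (U 0).1.mulVec (Pi.single init 1)
  | s + 1 => (U (s + 1)).1.mulVec ((queryMatrix W x).mulVec (evolution U init x s))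

lemma state_eq_evolution (Q : QueryAlgorithm M) (x : Fin M → ZMod 2) (s : ℕ) :
    Q.state x s = evolution Q.U Q.init x s := by
  induction s with
  | zero => rfl
  | succ s ih => rw [state, evolution, ih]

/-- The basis of the combined space, when the first algorithm has access to the query register. -/
def frontEquiv (W₁ W₂ : Type) :
    QueryBasis M (W₁ × QueryBasis M W₂) ≃ QueryBasis M W₁ × QueryBasis M W₂ where
  toFun b := ((b.1, b.2.1, b.2.2.1), b.2.2.2)
  invFun p := (p.1.1, p.1.2.1, p.1.2.2, p.2)

/-- The basis of the combined space, when the second algorithm has access to the query register. -/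
def backEquiv (W₁ W₂ : Type) :
    QueryBasis M (W₁ × QueryBasis M W₂) ≃ QueryBasis M W₁ × QueryBasis M W₂ where
  toFun b := ((b.2.2.2.1, b.2.2.2.2.1, b.2.2.1), (b.1, b.2.1, b.2.2.2.2.2))
  invFun p := (p.2.1, p.2.2.1, p.1.2.2, (p.1.1, p.1.2.1, p.2.2.2))

section evolution

variable {W₁ W₂ : Type} [Fintype W₁] [DecidableEq W₁] [Fintype W₂] [DecidableEq W₂]

lemma queryMatrix_mulVec_frontEquiv (x : Fin M → ZMod 2) (f : QueryBasis M W₁ → ℂ)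
    (g : QueryBasis M W₂ → ℂ) :
    (queryMatrix (W₁ × QueryBasis M W₂) x).mulVec
        (fun b => f (frontEquiv W₁ W₂ b).1 * g (frontEquiv W₁ W₂ b).2) =
      fun b => (queryMatrix W₁ x).mulVec f (frontEquiv W₁ W₂ b).1 * g (frontEquiv W₁ W₂ b).2 := by
  funext b
  rw [queryMatrix_mulVec, queryMatrix_mulVec]
  rfl

lemma queryMatrix_mulVec_backEquiv (x : Fin M → ZMod 2) (f : QueryBasis M W₁ → ℂ)
    (g : QueryBasis M W₂ → ℂ) :
    (queryMatrix (W₁ × QueryBasis M W₂) x).mulVec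
        (fun b => f (backEquiv W₁ W₂ b).1 * g (backEquiv W₁ W₂ b).2) =
      fun b => f (backEquiv W₁ W₂ b).1 * (queryMatrix W₂ x).mulVec g (backEquiv W₁ W₂ b).2 := by
  funext b
  rw [queryMatrix_mulVec, queryMatrix_mulVec]
  rfl

omit [Fintype W₁] [Fintype W₂] in
lemma single_frontEquiv_symm (b₁ : QueryBasis M W₁) (b₂ : QueryBasis M W₂) :
    (Pi.single ((frontEquiv W₁ W₂).symm (b₁, b₂)) 1 : QueryBasis M (W₁ × QueryBasis M W₂) → ℂ) =
      fun b => (Pi.single b₁ 1 : QueryBasis M W₁ → ℂ) (frontEquiv W₁ W₂ b).1 *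
        (Pi.single b₂ 1 : QueryBasis M W₂ → ℂ) (frontEquiv W₁ W₂ b).2 := by
  funext b
  have h : b = (frontEquiv W₁ W₂).symm (b₁, b₂) ↔
      (frontEquiv W₁ W₂ b).1 = b₁ ∧ (frontEquiv W₁ W₂ b).2 = b₂ := by
    rw [Equiv.eq_symm_apply, Prod.ext_iff]
  simp only [Pi.single_apply, h]
  split_ifs <;> simp_all

/-- The unitaries that run `q` queries with `U₁`, and then continue with `U₂` on a fresh register. -/
def combineUnitary (q : ℕ) (U₁ : ℕ → Matrix.unitaryGroup (QueryBasis M W₁) ℂ)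
    (U₂ : ℕ → Matrix.unitaryGroup (QueryBasis M W₂) ℂ) (s : ℕ) :
    Matrix.unitaryGroup (QueryBasis M (W₁ × QueryBasis M W₂)) ℂ :=
  if s < q then
    unitarySubmatrix (unitaryKronecker (U₁ s) 1) (frontEquiv _ _) (frontEquiv _ _)
  else if s = q then
    unitarySubmatrix (unitaryKronecker (U₁ s) (U₂ 0)) (backEquiv _ _) (frontEquiv _ _)
  else
    unitarySubmatrix (unitaryKronecker 1 (U₂ (s - q))) (backEquiv _ _) (backEquiv _ _)

variable (q : ℕ) (U₁ : ℕ → Matrix.unitaryGroup (QueryBasis M W₁) ℂ)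
  (U₂ : ℕ → Matrix.unitaryGroup (QueryBasis M W₂) ℂ)
  (b₁ : QueryBasis M W₁) (b₂ : QueryBasis M W₂) (x : Fin M → ZMod 2)

lemma evolution_combine_of_lt {s : ℕ} (hs : s < q) :
    evolution (combineUnitary q U₁ U₂) ((frontEquiv W₁ W₂).symm (b₁, b₂)) x s =
      fun b => evolution U₁ b₁ x s (frontEquiv W₁ W₂ b).1 *
        (Pi.single b₂ 1 : QueryBasis M W₂ → ℂ) (frontEquiv W₁ W₂ b).2 := by
  have hU : ∀ s < q, combineUnitary q U₁ U₂ s =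
      unitarySubmatrix (unitaryKronecker (U₁ s) 1) (frontEquiv _ _) (frontEquiv _ _) :=
    fun s hs => if_pos hs
  induction s with
  | zero =>
    rw [evolution, single_frontEquiv_symm, hU _ hs, unitarySubmatrix_kronecker_mulVec,
      OneMemClass.coe_one, Matrix.one_mulVec]
    rfl
  | succ s ih =>
    rw [evolution, ih (by omega), queryMatrix_mulVec_frontEquiv, hU _ hs,
      unitarySubmatrix_kronecker_mulVec, OneMemClass.coe_one, Matrix.one_mulVec]
    rfl

/-- At step `q` the columns are labelled by `frontEquiv` and the rows by `backEquiv`. Besides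
applying `U₁ q` and `U₂ 0`, that unitary thus exchanges the query registers, and all later queries
act on the second factor only. -/
lemma evolution_combine_add (s : ℕ) :
    evolution (combineUnitary q U₁ U₂) ((frontEquiv W₁ W₂).symm (b₁, b₂)) x (q + s) =
      fun b => evolution U₁ b₁ x q (backEquiv W₁ W₂ b).1 *
        evolution U₂ b₂ x s (backEquiv W₁ W₂ b).2 := by
  induction s with
  | zero =>
    have hU : combineUnitary q U₁ U₂ q = unitarySubmatrix (unitaryKronecker (U₁ q) (U₂ 0))
        (backEquiv _ _) (frontEquiv _ _) :=
      (if_neg (lt_irrefl _)).trans (if_pos rfl)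
    rw [add_zero]
    cases q with
    | zero =>
      rw [evolution, single_frontEquiv_symm, hU, unitarySubmatrix_kronecker_mulVec]
      rfl
    | succ q =>
      rw [evolution.eq_2, evolution_combine_of_lt _ _ _ _ _ _ (lt_add_one q),
        queryMatrix_mulVec_frontEquiv, hU, unitarySubmatrix_kronecker_mulVec]
      rfl
  | succ s ih =>
    have hU : combineUnitary q U₁ U₂ (q + s + 1) =
        unitarySubmatrix (unitaryKronecker 1 (U₂ (s + 1))) (backEquiv _ _) (backEquiv _ _) := by
      rw [combineUnitary, if_neg (by omega), if_neg (by omega), show q + s + 1 - q = s + 1 by omega]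
    rw [← add_assoc, evolution, ih, queryMatrix_mulVec_backEquiv, hU,
      unitarySubmatrix_kronecker_mulVec, OneMemClass.coe_one, Matrix.one_mulVec]
    rfl

end evolution

/-- Run `Q₁`, then `Q₂` on a fresh register, and output a function of the two outcomes. -/
def combine (Q₁ Q₂ : QueryAlgorithm M) (f : ZMod 2 → ZMod 2 → ZMod 2) : QueryAlgorithm M where
  W := Q₁.W × QueryBasis M Q₂.W
  queries := Q₁.queries + Q₂.queries
  init := (frontEquiv Q₁.W Q₂.W).symm (Q₁.init, Q₂.init)
  U := combineUnitary Q₁.queries Q₁.U Q₂.U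
  out b := f (Q₁.out (backEquiv _ _ b).1) (Q₂.out (backEquiv _ _ b).2)

section combine

variable (Q₁ Q₂ : QueryAlgorithm M) (f : ZMod 2 → ZMod 2 → ZMod 2) (x : Fin M → ZMod 2)

lemma state_combine :
    (combine Q₁ Q₂ f).state x (combine Q₁ Q₂ f).queries =
      fun b => Q₁.state x Q₁.queries (backEquiv Q₁.W Q₂.W b).1 *
        Q₂.state x Q₂.queries (backEquiv Q₁.W Q₂.W b).2 := by
  simp only [state_eq_evolution]
  exact evolution_combine_add _ _ _ _ _ _ _

/-- The final state is a product state, so the two outcomes are independent. -/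
lemma outputProb_combine (v : ZMod 2) :
    (combine Q₁ Q₂ f).outputProb x v =
      ∑ p : ZMod 2 × ZMod 2 with f p.1 p.2 = v, Q₁.outputProb x p.1 * Q₂.outputProb x p.2 := by
  have h1 : (combine Q₁ Q₂ f).outputProb x v =
      ∑ p : QueryBasis M Q₁.W × QueryBasis M Q₂.W with f (Q₁.out p.1) (Q₂.out p.2) = v,
        ‖Q₁.state x Q₁.queries p.1‖ ^ 2 * ‖Q₂.state x Q₂.queries p.2‖ ^ 2 := by
    rw [outputProb, state_combine]
    simp only [norm_mul, mul_pow, Finset.sum_filter]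
    exact Equiv.sum_comp (backEquiv Q₁.W Q₂.W)
      (fun p => if f (Q₁.out p.1) (Q₂.out p.2) = v then
        ‖Q₁.state x Q₁.queries p.1‖ ^ 2 * ‖Q₂.state x Q₂.queries p.2‖ ^ 2 else 0)
  rw [h1, ← Finset.sum_fiberwise_of_maps_to
    (t := Finset.univ.filter fun p : ZMod 2 × ZMod 2 => f p.1 p.2 = v)
    (g := fun p => (Q₁.out p.1, Q₂.out p.2)) (by intro p hp; simpa using hp)]
  refine Finset.sum_congr rfl fun u hu => ?_
  rw [outputProb, outputProb, Finset.sum_mul_sum, ← Finset.sum_product']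
  refine Finset.sum_congr ?_ fun _ _ => rfl
  ext p
  simp only [Finset.mem_filter, Finset.mem_univ, true_and, Finset.mem_product, Prod.ext_iff]
  simp only [Finset.mem_filter, Finset.mem_univ, true_and] at hu
  constructor
  · rintro ⟨_, h⟩; exact h
  · rintro ⟨h, h'⟩; exact ⟨by rw [h, h', hu], h, h'⟩

lemma outputProb_combine_mul_zero :
    (combine Q₁ Q₂ (· * ·)).outputProb x 0 ≤ Q₁.outputProb x 0 + Q₂.outputProb x 0 := by
  have hs : (Finset.univ.filter fun p : ZMod 2 × ZMod 2 => p.1 * p.2 = 0) =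
    {(0, 0), (0, 1), (1, 0)} := by decide
  rw [outputProb_combine, hs]
  have h1 := Q₁.sum_outputProb x
  have h2 := Q₂.sum_outputProb x
  rw [Finset.sum_insert (by decide), Finset.sum_insert (by decide), Finset.sum_singleton]
  have := mul_nonneg (Q₁.outputProb_nonneg x 0) (Q₂.outputProb_nonneg x 0)
  rw [← eq_sub_iff_add_eq'] at h1 h2
  simp only [h1, h2]
  nlinarith

lemma outputProb_combine_mul_one :
    (combine Q₁ Q₂ (· * ·)).outputProb x 1 = Q₁.outputProb x 1 * Q₂.outputProb x 1 := by
  have hs : (Finset.univ.filter fun p : ZMod 2 × ZMod 2 => p.1 * p.2 = 1) = {(1, 1)} := by decide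
  rw [outputProb_combine, hs, Finset.sum_singleton]

/-- The sum of two bits is wrong exactly when one of them is wrong and the other is right. -/
lemma errorProb_combine_add (F G : (Fin M → ZMod 2) → ZMod 2) :
    (combine Q₁ Q₂ (· + ·)).errorProb (fun x => F x + G x) x ≤
      Q₁.errorProb F x + Q₂.errorProb G x := by
  have hs : ∀ u v : ZMod 2, (Finset.univ.filter fun p : ZMod 2 × ZMod 2 => p.1 + p.2 = u + v + 1) =
    {(u, v + 1), (u + 1, v)} := by decide
  have hne : ∀ u v : ZMod 2, (u, v + 1) ∉ ({(u + 1, v)} : Finset (ZMod 2 × ZMod 2)) := by decide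
  have hle : ∀ (Q : QueryAlgorithm M) v, Q.outputProb x v ≤ 1 := by
    intro Q v
    have h := Q.sum_outputProb x
    have h0 := Q.outputProb_nonneg x 0
    have h1 := Q.outputProb_nonneg x 1
    obtain rfl | rfl : v = 0 ∨ v = 1 := by revert v; decide
    all_goals linarith
  simp only [errorProb_eq]
  rw [outputProb_combine, hs, Finset.sum_insert (hne _ _), Finset.sum_singleton, add_comm]
  exact add_le_add (mul_le_of_le_one_right (outputProb_nonneg _ _ _) (hle _ _))
    (mul_le_of_le_one_left (outputProb_nonneg _ _ _) (hle _ _))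

end combine

end QueryAlgorithm

/-! ### Reflections and state preparation -/

/-- For a real vector `u`, the matrix `c u uᵀ - 1`; it is a reflection if `c ‖u‖² = 2`. -/
noncomputable def reflectionUnitary {α : Type} [Fintype α] [DecidableEq α] (u : α → ℝ) (c : ℝ)
    (h : c * ∑ a, u a ^ 2 = 2) : Matrix.unitaryGroup α ℂ :=
  ⟨(Matrix.of fun a b => (c * u a * u b : ℝ) - if a = b then (1 : ℂ) else 0), by
    rw [Matrix.mem_unitaryGroup_iff]
    ext a b
    have h' : (c : ℂ) * ∑ a, (u a : ℂ) ^ 2 = 2 := by exact_mod_cast h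
    simp only [Matrix.mul_apply, Matrix.star_apply, Matrix.of_apply, star_sub, apply_ite star,
      star_one, star_zero, RCLike.star_def, Complex.conj_ofReal, sub_mul, mul_sub,
      Finset.sum_sub_distrib, mul_ite, ite_mul, mul_one, one_mul, mul_zero, zero_mul,
      Finset.sum_ite_eq, Finset.mem_univ, if_true, Matrix.one_apply]
    have hs : ∑ d, ((c * u a * u d : ℝ) : ℂ) * ((c * u b * u d : ℝ) : ℂ) =
        2 * (c * u a * u b : ℝ) := by
      rw [← h', Finset.mul_sum, Finset.sum_mul]
      refine Finset.sum_congr rfl fun d _ => ?_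
      push_cast
      ring
    rw [hs]
    push_cast
    by_cases hab : a = b
    · subst hab; simp; ring
    · simp [hab]; ring⟩

lemma reflectionUnitary_mulVec {α : Type} [Fintype α] [DecidableEq α] (u : α → ℝ) (c : ℝ)
    (h : c * ∑ a, u a ^ 2 = 2) (v : α → ℂ) (a : α) :
    (reflectionUnitary u c h).1.mulVec v a = c * u a * ∑ b, u b * v b - v a := by
  simp only [reflectionUnitary, Matrix.mulVec, dotProduct, Matrix.of_apply, sub_mul,
    Finset.sum_sub_distrib, ite_mul, one_mul, zero_mul, Finset.sum_ite_eq, Finset.mem_univ,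
    if_true, Finset.mul_sum]
  push_cast
  simp only [mul_assoc]

/-- The reflection that fixes `e + u`, with `e` the basis vector at `a₀`, exchanges the unit vectors
`e` and `u`. Since `‖e + u‖² = 2 (1 + u a₀)`, the sign condition on `u a₀` keeps this vector
nonzero. -/
lemma exists_unitary_mulVec_single {α : Type} [Fintype α] [DecidableEq α] (u : α → ℝ)
    (hu : ∑ a, u a ^ 2 = 1) (a₀ : α) (h₀ : 0 ≤ u a₀) :
    ∃ U : Matrix.unitaryGroup α ℂ, U.1.mulVec (Pi.single a₀ 1) = fun a => (u a : ℂ) := by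
  have h1 : (1 + u a₀) ≠ 0 := by positivity
  have h1' : (1 + u a₀ : ℂ) ≠ 0 := by exact_mod_cast h1
  have hs : (1 + u a₀)⁻¹ * ∑ a, ((Pi.single a₀ 1 : α → ℝ) a + u a) ^ 2 = 2 := by
    have : ∑ a, ((Pi.single a₀ 1 : α → ℝ) a + u a) ^ 2 = 2 * (1 + u a₀) := by
      simp only [add_sq, Finset.sum_add_distrib, hu, Pi.single_apply]
      simp
      ring
    rw [this]
    field_simp
  refine ⟨reflectionUnitary (fun a => (Pi.single a₀ 1 : α → ℝ) a + u a) _ hs, ?_⟩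
  funext a
  rw [reflectionUnitary_mulVec]
  have : ∑ b, (((Pi.single a₀ 1 : α → ℝ) b + u b : ℝ) : ℂ) * (Pi.single a₀ 1 : α → ℂ) b =
      1 + u a₀ := by
    simp [Pi.single_apply]
  rw [this]
  have hc : (((Pi.single a₀ 1 : α → ℝ) a : ℝ) : ℂ) = (Pi.single a₀ 1 : α → ℂ) a := by
    simp only [Pi.single_apply]; split_ifs <;> simp
  push_cast
  rw [hc]
  field_simp
  ring

/-- The unitary that changes the sign of the basis states with answer register `0`. -/
noncomputable def signUnitary (M : ℕ) : Matrix.unitaryGroup (QueryBasis M Unit) ℂ :=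
  ⟨Matrix.diagonal fun b => if b.2.1 = 0 then -1 else 1, by
    rw [Matrix.mem_unitaryGroup_iff, Matrix.star_eq_conjTranspose, Matrix.diagonal_conjTranspose,
      Matrix.diagonal_mul_diagonal, ← Matrix.diagonal_one]
    congr 1
    funext b
    simp only [Pi.star_apply]
    split_ifs <;> simp⟩

/-! ### Grover search for a zero -/

section Grover

variable {M : ℕ} (S : Finset (Fin M))

/-- The uniform superposition of the basis states that query the variables in `S`. -/
noncomputable def uniformState (b : QueryBasis M Unit) : ℝ :=
  if b.1 ∈ S ∧ b.2.1 = 0 then (√(S.card : ℝ))⁻¹ else 0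

/-- The state whose amplitudes are `α` at the zeros of `x` in `S` and `β` at the ones. -/
noncomputable def twoLevelState (x : Fin M → ZMod 2) (α β : ℝ) (b : QueryBasis M Unit) : ℂ :=
  if b.1 ∈ S ∧ b.2.1 = 0 then (if x b.1 = 0 then (α : ℂ) else β) else 0

variable {S}

lemma sum_queryBasis_unit {R : Type} [AddCommMonoid R] (f : QueryBasis M Unit → R) :
    ∑ b, f b = ∑ i, ∑ z, f (i, z, ()) := by
  simp only [Fintype.sum_prod_type, Fintype.sum_unique]

lemma sum_ite_mem_and_eq_zero {R : Type} [AddCommMonoid R] (f : Fin M → R) :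
    ∑ b : QueryBasis M Unit, (if b.1 ∈ S ∧ b.2.1 = 0 then f b.1 else 0) = ∑ i ∈ S, f i := by
  simp [sum_queryBasis_unit, ite_and]

lemma sum_uniformState_sq (hS : S.Nonempty) : ∑ b, uniformState S b ^ 2 = 1 := by
  have hc : (S.card : ℝ) ≠ 0 := by exact_mod_cast hS.card_pos.ne'
  have : ∀ b : QueryBasis M Unit, uniformState S b ^ 2 =
      if b.1 ∈ S ∧ b.2.1 = 0 then (S.card : ℝ)⁻¹ else 0 := by
    intro b
    rw [uniformState]
    split_ifs <;> simp
  simp only [this]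
  rw [sum_ite_mem_and_eq_zero (fun _ => (S.card : ℝ)⁻¹)]
  simp [hc]

/-- The diffusion operator of Grover search over `S`. -/
noncomputable def diffusionUnitary (hS : S.Nonempty) :
    Matrix.unitaryGroup (QueryBasis M Unit) ℂ :=
  reflectionUnitary (uniformState S) 2 (by rw [sum_uniformState_sq hS, mul_one])

lemma sum_uniformState_mul_twoLevelState (x : Fin M → ZMod 2) (α β : ℝ) :
    ∑ b, (uniformState S b : ℂ) * twoLevelState S x α β b =
      (((√(S.card : ℝ))⁻¹ * ((S.filter (x · = 0)).card * α +
        (S.filter (x · ≠ 0)).card * β) : ℝ) : ℂ) := by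
  have h : ∀ b : QueryBasis M Unit, (uniformState S b : ℂ) * twoLevelState S x α β b =
      if b.1 ∈ S ∧ b.2.1 = 0 then
        (((√(S.card : ℝ))⁻¹ * (if x b.1 = 0 then α else β) : ℝ) : ℂ) else 0 := by
    intro b
    rw [uniformState, twoLevelState]
    split_ifs <;> simp
  simp only [h]
  rw [sum_ite_mem_and_eq_zero
    (fun i => (((√(S.card : ℝ))⁻¹ * (if x i = 0 then α else β) : ℝ) : ℂ)),
    ← Complex.ofReal_sum, ← Finset.mul_sum, Finset.sum_ite]
  simp

/-- Inversion about the mean: each amplitude is replaced by twice the average amplitude over `S`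
minus itself. -/
lemma diffusionUnitary_mulVec (hS : S.Nonempty) (x : Fin M → ZMod 2) (α β : ℝ) :
    (diffusionUnitary hS).1.mulVec (twoLevelState S x α β) =
      twoLevelState S x
        (2 / S.card * ((S.filter (x · = 0)).card * α + (S.filter (x · ≠ 0)).card * β) - α)
        (2 / S.card * ((S.filter (x · = 0)).card * α + (S.filter (x · ≠ 0)).card * β) - β) := by
  funext b
  rw [diffusionUnitary, reflectionUnitary_mulVec, sum_uniformState_mul_twoLevelState]
  have hq : (√(S.card : ℝ))⁻¹ * (√(S.card : ℝ))⁻¹ = (S.card : ℝ)⁻¹ := by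
    rw [← mul_inv, Real.mul_self_sqrt (Nat.cast_nonneg _)]
  have hm : ∀ y : ℝ, 2 * (√(S.card : ℝ))⁻¹ * ((√(S.card : ℝ))⁻¹ * y) = 2 / S.card * y := by
    intro y
    rw [div_eq_mul_inv, ← hq]; ring
  rw [twoLevelState, twoLevelState, uniformState]
  split_ifs
  · rw [← Complex.ofReal_mul, ← Complex.ofReal_mul, hm,
      ← Complex.ofReal_sub]
  · rw [← Complex.ofReal_mul, ← Complex.ofReal_mul, hm,
      ← Complex.ofReal_sub]
  · simp

lemma signUnitary_mulVec_query (x : Fin M → ZMod 2) (α β : ℝ) (b : QueryBasis M Unit) :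
    (signUnitary M).1.mulVec ((queryMatrix Unit x).mulVec (twoLevelState S x α β)) b =
      (if b.2.1 = 0 then -1 else 1) *
        twoLevelState S x α β (b.1, b.2.1 + x b.1, b.2.2) := by
  rw [signUnitary, Matrix.mulVec_diagonal, queryMatrix_mulVec]

/-- The second query uncomputes the answer register, so only the phase at the zeros of `x` remains.
Hence an iteration costs two queries. -/
lemma query_sign_query (x : Fin M → ZMod 2) (α β : ℝ) :
    (queryMatrix Unit x).mulVec
        ((signUnitary M).1.mulVec ((queryMatrix Unit x).mulVec (twoLevelState S x α β))) =
      twoLevelState S x (-α) β := by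
  funext b
  have h2 : ∀ u y : ZMod 2, u + y + y = u := by decide
  rw [queryMatrix_mulVec, signUnitary_mulVec_query]
  simp only [h2, twoLevelState]
  by_cases h : b.1 ∈ S ∧ b.2.1 = 0
  · rw [if_pos h, if_pos h, h.2, zero_add]
    split_ifs <;> simp
  · rw [if_neg h, if_neg h, mul_zero]

/-- A unitary that prepares the uniform superposition. -/
lemma exists_prepareUnitary (hS : S.Nonempty) : ∃ U : Matrix.unitaryGroup (QueryBasis M Unit) ℂ,
    U.1.mulVec (Pi.single (hS.choose, 0, ()) 1) = fun b => (uniformState S b : ℂ) :=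
  exists_unitary_mulVec_single (uniformState S) (sum_uniformState_sq hS) (hS.choose, 0, ())
    (by rw [uniformState]; positivity)

/-- The unitaries of Grover search: preparation, then phase flips alternating with diffusions. -/
noncomputable def groverUnitary (hS : S.Nonempty) (s : ℕ) :
    Matrix.unitaryGroup (QueryBasis M Unit) ℂ :=
  if s = 0 then (exists_prepareUnitary hS).choose
  else if s % 2 = 0 then diffusionUnitary hS else signUnitary M

/-- Grover search for a zero among the variables in `S`, with `r` iterations, followed by a query at
the position that was found; the output is the answer to that query. -/
noncomputable def grover (hS : S.Nonempty) (r : ℕ) : QueryAlgorithm M where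
  W := Unit
  queries := 2 * r + 1
  init := (hS.choose, 0, ())
  U := groverUnitary hS
  out b := b.2.1

/-- The angle whose sine is the square root of the fraction of the variables in `S` that are `0`. -/
noncomputable def groverAngle (S : Finset (Fin M)) (x : Fin M → ZMod 2) : ℝ :=
  Real.arcsin √((S.filter (x · = 0)).card / S.card)

lemma card_zeros_add_card_ones (S : Finset (Fin M)) (x : Fin M → ZMod 2) :
    ((S.filter (x · = 0)).card : ℝ) + (S.filter (x · ≠ 0)).card = S.card := by
  exact_mod_cast S.card_filter_add_card_filter_not (x · = 0)

lemma sin_groverAngle (x : Fin M → ZMod 2) :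
    Real.sin (groverAngle S x) = √(S.filter (x · = 0)).card / √S.card := by
  rw [groverAngle, Real.sin_arcsin, Real.sqrt_div (Nat.cast_nonneg _)]
  · linarith [Real.sqrt_nonneg (((S.filter (x · = 0)).card : ℝ) / S.card)]
  · rw [Real.sqrt_le_one]
    refine div_le_one_of_le₀ ?_ (Nat.cast_nonneg _)
    exact_mod_cast Finset.card_filter_le _ _

lemma cos_groverAngle (hS : S.Nonempty) (x : Fin M → ZMod 2) :
    Real.cos (groverAngle S x) = √(S.filter (x · ≠ 0)).card / √S.card := by
  have hc : (S.card : ℝ) ≠ 0 := by exact_mod_cast hS.card_pos.ne'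
  rw [groverAngle, Real.cos_arcsin, Real.sq_sqrt (by positivity),
    ← Real.sqrt_div (Nat.cast_nonneg _)]
  congr 1
  rw [eq_div_iff hc, sub_mul, div_mul_cancel₀ _ hc]
  linarith [card_zeros_add_card_ones S x]

/-- The two products are the coordinates of the state along the normalized superpositions of zeros
and of ones; each iteration rotates this plane by `2θ`. Multiplying by the square roots, rather than
solving for `α` and `β`, covers the case of no zeros or no ones. -/
lemma evolution_grover (hS : S.Nonempty) (x : Fin M → ZMod 2) (r : ℕ) :
    ∃ α β : ℝ, QueryAlgorithm.evolution (groverUnitary hS) (hS.choose, 0, ()) x (2 * r) =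
        twoLevelState S x α β ∧
      √(S.filter (x · = 0)).card * α = Real.sin ((2 * r + 1) * groverAngle S x) ∧
      √(S.filter (x · ≠ 0)).card * β = Real.cos ((2 * r + 1) * groverAngle S x) := by
  have hc : (0 : ℝ) < S.card := by exact_mod_cast hS.card_pos
  induction r with
  | zero =>
    refine ⟨(√(S.card : ℝ))⁻¹, (√(S.card : ℝ))⁻¹, ?_, ?_, ?_⟩
    · rw [mul_zero, QueryAlgorithm.evolution]
      have h0 : groverUnitary hS 0 = (exists_prepareUnitary hS).choose := if_pos rfl
      rw [h0]
      refine (exists_prepareUnitary hS).choose_spec.trans ?_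
      funext b
      simp only [uniformState, twoLevelState]
      split_ifs <;> simp
    · simp [sin_groverAngle, div_eq_mul_inv]
    · simp [cos_groverAngle hS, div_eq_mul_inv]
  | succ r ih =>
    obtain ⟨α, β, hst, hα, hβ⟩ := ih
    set g : ℝ := ((S.filter (x · = 0)).card : ℝ) with hg
    set h : ℝ := ((S.filter (x · ≠ 0)).card : ℝ) with hh
    set θ := groverAngle S x
    have hsin : Real.sin θ = √g / √S.card := sin_groverAngle x
    have hcos : Real.cos θ = √h / √S.card := cos_groverAngle hS x
    have hgs : √g ^ 2 = g := Real.sq_sqrt (Nat.cast_nonneg _)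
    have hhs : √h ^ 2 = h := Real.sq_sqrt (Nat.cast_nonneg _)
    have hns : √(S.card : ℝ) ^ 2 = S.card := Real.sq_sqrt hc.le
    have hq : (√(S.card : ℝ))⁻¹ ^ 2 = (S.card : ℝ)⁻¹ := by rw [inv_pow, hns]
    have hK : (g + h) * (S.card : ℝ)⁻¹ = 1 := by
      rw [show g + h = S.card from card_zeros_add_card_ones S x, mul_inv_cancel₀ hc.ne']
    have harg : (2 * ((r + 1 : ℕ) : ℝ) + 1) * θ = (2 * r + 1) * θ + 2 * θ := by push_cast; ring
    refine ⟨2 / S.card * (g * (-α) + h * β) - (-α), 2 / S.card * (g * (-α) + h * β) - β,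
      ?_, ?_, ?_⟩
    · have h1 : groverUnitary hS (2 * r + 1) = signUnitary M := by
        rw [groverUnitary, if_neg (by omega), if_neg (by omega)]
      have h2 : groverUnitary hS (2 * r + 1 + 1) = diffusionUnitary hS := by
        rw [groverUnitary, if_neg (by omega), if_pos (by omega)]
      rw [show 2 * (r + 1) = 2 * r + 1 + 1 by ring, QueryAlgorithm.evolution,
        QueryAlgorithm.evolution, hst, h1, h2, query_sign_query, diffusionUnitary_mulVec]
    · rw [harg, Real.sin_add, ← hα, ← hβ, Real.sin_two_mul, Real.cos_two_mul', hsin, hcos,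
        div_pow, div_pow, hgs, hhs, hns]
      simp only [div_eq_mul_inv]
      linear_combination (-√g * α) * hK + (-2 * √g * β * (√S.card)⁻¹ ^ 2) * hhs +
        (-2 * √g * β * h) * hq
    · rw [harg, Real.cos_add, ← hα, ← hβ, Real.sin_two_mul, Real.cos_two_mul', hsin, hcos,
        div_pow, div_pow, hgs, hhs, hns]
      simp only [div_eq_mul_inv]
      linear_combination (√h * β) * hK + (2 * √h * α * (√S.card)⁻¹ ^ 2) * hgs +
        (2 * √h * α * g) * hq

/-- The last query copies `x i` into the answer register, so output `1` means that a one was found.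
The sign unitary that follows it changes phases only. -/
lemma outputProb_grover_one (hS : S.Nonempty) (r : ℕ) (x : Fin M → ZMod 2) :
    (grover hS r).outputProb x 1 = Real.cos ((2 * r + 1) * groverAngle S x) ^ 2 := by
  obtain ⟨α, β, hst, -, hβ⟩ := evolution_grover hS x r
  have hq : (grover hS r).state x (grover hS r).queries = fun b : QueryBasis M Unit =>
      (if b.2.1 = 0 then -1 else 1) * twoLevelState S x α β (b.1, b.2.1 + x b.1, b.2.2) := by
    have h1 : groverUnitary hS (2 * r + 1) = signUnitary M := by
      rw [groverUnitary, if_neg (by omega), if_neg (by omega)]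
    rw [QueryAlgorithm.state_eq_evolution]
    change QueryAlgorithm.evolution (groverUnitary hS) (hS.choose, 0, ()) x (2 * r + 1) = _
    rw [QueryAlgorithm.evolution, hst, h1]
    funext b
    exact signUnitary_mulVec_query x α β b
  have hone : ∀ y : ZMod 2, 1 + y = 0 ↔ y ≠ 0 := by decide
  rw [QueryAlgorithm.outputProb, hq, ← hβ, mul_pow, Real.sq_sqrt (Nat.cast_nonneg _)]
  change ∑ b : QueryBasis M Unit with b.2.1 = 1, _ = _
  rw [Finset.sum_filter]
  have : ∀ b : QueryBasis M Unit, (if b.2.1 = 1 then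
      ‖(if b.2.1 = 0 then -1 else 1) * twoLevelState S x α β (b.1, b.2.1 + x b.1, b.2.2)‖ ^ 2
      else 0) = if b.2.1 = 1 then (if b.1 ∈ S ∧ x b.1 ≠ 0 then β ^ 2 else 0) else 0 := by
    rintro ⟨i, z, w⟩
    by_cases hz : z = 1
    · subst hz
      by_cases h : i ∈ S ∧ x i ≠ 0
      · simp [twoLevelState, h, hone]
      · simp only [twoLevelState, h, hone]; simp
    · simp [hz]
  simp only [this]
  rw [sum_queryBasis_unit]
  simp only [Finset.sum_ite_eq', Finset.mem_univ, if_true]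
  rw [← Finset.sum_filter, Finset.sum_const, nsmul_eq_mul]
  congr 3
  ext i
  simp

lemma outputProb_grover_zero_of_forall (hS : S.Nonempty) (r : ℕ) (x : Fin M → ZMod 2)
    (hx : ∀ i ∈ S, x i = 1) : (grover hS r).outputProb x 0 = 0 := by
  have h : S.filter (x · = 0) = ∅ :=
    Finset.filter_eq_empty_iff.2 fun i hi => by rw [hx i hi]; decide
  have h0 : groverAngle S x = 0 := by rw [groverAngle, h]; simp
  have h1 := outputProb_grover_one hS r x
  rw [h0, mul_zero, Real.cos_zero, one_pow] at h1
  linarith [(grover hS r).sum_outputProb x]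

end Grover

/-! ### One-sided error and amplification -/

namespace QueryAlgorithm

variable {M : ℕ}

/-- `Q` always outputs `F x` where `F x = 1`, and errs with probability at most `ε x` elsewhere. -/
def IsOneSided (Q : QueryAlgorithm M) (F : (Fin M → ZMod 2) → ZMod 2)
    (ε : (Fin M → ZMod 2) → ℝ) : Prop :=
  ∀ x, (F x = 1 → Q.outputProb x 0 = 0) ∧ (F x = 0 → Q.outputProb x 1 ≤ ε x)

/-- The algorithm that makes no queries and outputs `c`. -/
def const (i : Fin M) (c : ZMod 2) : QueryAlgorithm M where
  W := Unit
  queries := 0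
  init := (i, 0, ())
  U _ := 1
  out _ := c

lemma outputProb_const_of_ne (i : Fin M) {c v : ZMod 2} (h : c ≠ v) (x : Fin M → ZMod 2) :
    (const i c).outputProb x v = 0 := by
  rw [outputProb, Finset.filter_false_of_mem, Finset.sum_empty]
  exact fun _ _ => h

lemma errorProb_const (i : Fin M) (c : ZMod 2) (x : Fin M → ZMod 2) :
    (const i c).errorProb (fun _ => c) x = 0 := by
  rw [errorProb_eq]
  refine outputProb_const_of_ne i ?_ x
  revert c; decide

lemma IsOneSided.combine {Q₁ Q₂ : QueryAlgorithm M} {F : (Fin M → ZMod 2) → ZMod 2}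
    {ε₁ ε₂ : (Fin M → ZMod 2) → ℝ} (h₁ : Q₁.IsOneSided F ε₁) (h₂ : Q₂.IsOneSided F ε₂) :
    (combine Q₁ Q₂ (· * ·)).IsOneSided F (fun x => ε₁ x * ε₂ x) := by
  refine fun x => ⟨fun hx => le_antisymm ?_ (outputProb_nonneg _ _ _), fun hx => ?_⟩
  · refine (outputProb_combine_mul_zero Q₁ Q₂ x).trans ?_
    rw [(h₁ x).1 hx, (h₂ x).1 hx, add_zero]
  · rw [outputProb_combine_mul_one]
    exact mul_le_mul ((h₁ x).2 hx) ((h₂ x).2 hx) (outputProb_nonneg _ _ _)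
      ((outputProb_nonneg _ _ _).trans ((h₁ x).2 hx))

/-- The bounds `ε l` depend on `x` because the Grover run that succeeds varies with the number of
zeros of the input. -/
lemma exists_isOneSided_prod (i : Fin M) (Q : ℕ → QueryAlgorithm M)
    (F : (Fin M → ZMod 2) → ZMod 2) (ε : ℕ → (Fin M → ZMod 2) → ℝ)
    (h : ∀ l, (Q l).IsOneSided F (ε l)) (n : ℕ) :
    ∃ Q' : QueryAlgorithm M, Q'.queries = ∑ l ∈ Finset.range n, (Q l).queries ∧
      Q'.IsOneSided F (fun x => ∏ l ∈ Finset.range n, ε l x) := by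
  induction n with
  | zero =>
    refine ⟨const i 1, rfl, fun x => ⟨fun _ => ?_, fun _ => ?_⟩⟩
    · exact outputProb_const_of_ne i (by decide) x
    · simp only [Finset.range_zero, Finset.prod_empty]
      linarith [(const i 1).sum_outputProb x, (const i 1).outputProb_nonneg x 0]
  | succ n ih =>
    obtain ⟨Q', hq, hQ'⟩ := ih
    refine ⟨Q'.combine (Q n) (· * ·), ?_, ?_⟩
    · rw [Finset.sum_range_succ, ← hq]; rfl
    · simp only [Finset.prod_range_succ]
      exact hQ'.combine (h n)

lemma IsOneSided.errorProb_le {Q : QueryAlgorithm M} {F : (Fin M → ZMod 2) → ZMod 2} {ε : ℝ}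
    (h : Q.IsOneSided F (fun _ => ε)) (hε : 0 ≤ ε) (x : Fin M → ZMod 2) :
    Q.errorProb F x ≤ ε := by
  rw [errorProb_eq]
  obtain hx | hx : F x = 0 ∨ F x = 1 := by generalize F x = u; revert u; decide
  · rw [hx, zero_add]; exact (h x).2 hx
  · rw [hx, show (1 + 1 : ZMod 2) = 0 by decide, (h x).1 hx]; exact hε

lemma exists_errorProb_add_sum_le {ι : Type*} (i₀ : Fin M) (a : ZMod 2)
    (F : ι → (Fin M → ZMod 2) → ZMod 2) (q : ι → ℝ) (ε : ℝ)
    (h : ∀ i, ∃ Q : QueryAlgorithm M, (Q.queries : ℝ) ≤ q i ∧ ∀ x, Q.errorProb (F i) x ≤ ε)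
    (s : Finset ι) :
    ∃ Q : QueryAlgorithm M, (Q.queries : ℝ) ≤ ∑ i ∈ s, q i ∧
      ∀ x, Q.errorProb (fun x => a + ∑ i ∈ s, F i x) x ≤ s.card * ε := by
  classical
  induction s using Finset.induction_on with
  | empty =>
    refine ⟨const i₀ a, by simp [const], fun x => ?_⟩
    simp [errorProb_const]
  | insert i s hi ih =>
    obtain ⟨Q₁, hq₁, hQ₁⟩ := ih
    obtain ⟨Q₂, hq₂, hQ₂⟩ := h i
    refine ⟨combine Q₁ Q₂ (· + ·), ?_, fun x => ?_⟩
    · rw [Finset.sum_insert hi, combine]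
      push_cast
      linarith
    · have := errorProb_combine_add Q₁ Q₂ x (fun x => a + ∑ i ∈ s, F i x) (F i)
      simp only [Finset.sum_insert hi, Finset.card_insert_of_notMem hi]
      simp only [add_comm (F i _), ← add_assoc]
      push_cast
      linarith [hQ₁ x, hQ₂ x]

end QueryAlgorithm

/-! ### Evaluating conjunctions and the polynomial -/

open QueryAlgorithm

/-- Tripling the angle cannot jump over `[π/4, 3π/4]`, where `cos² ≤ 1/2`: the first multiple that
reaches `π/4` is still at most `3π/4`. -/
lemma exists_cos_three_pow_mul_sq_le {θ : ℝ} (h₀ : θ ≤ Real.pi / 2) {L : ℕ}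
    (hL : 1 ≤ 3 ^ L * θ) : ∃ l ≤ L, Real.cos (3 ^ l * θ) ^ 2 ≤ 1 / 2 := by
  classical
  have hpi := Real.pi_le_four
  have hex : ∃ l, Real.pi / 4 ≤ 3 ^ l * θ := ⟨L, by linarith⟩
  refine ⟨Nat.find hex, Nat.find_min' hex (by linarith), ?_⟩
  have h1 : Real.pi / 4 ≤ 3 ^ Nat.find hex * θ := Nat.find_spec hex
  have h2 : 3 ^ Nat.find hex * θ ≤ 3 * (Real.pi / 4) := by
    rcases hl : Nat.find hex with _ | l
    · rw [pow_zero, one_mul]; linarith [Real.pi_pos]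
    · have := Nat.find_min hex (m := l) (by omega)
      rw [pow_succ]
      linarith
  rw [Real.cos_sq]
  have := Real.cos_nonpos_of_pi_div_two_le_of_le (x := 2 * (3 ^ Nat.find hex * θ))
    (by linarith) (by linarith)
  linarith

lemma exists_isOneSided_half {M : ℕ} {S : Finset (Fin M)} (hS : S.Nonempty)
    (F : (Fin M → ZMod 2) → ZMod 2) (h₁ : ∀ x, F x = 1 → ∀ i ∈ S, x i = 1)
    (h₀ : ∀ x, F x = 0 → ∃ i ∈ S, x i = 0) :
    ∃ Q : QueryAlgorithm M, (Q.queries : ℝ) ≤ 9 / 2 * √S.card ∧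
      Q.IsOneSided F (fun _ => 1 / 2) := by
  have hc : (1 : ℝ) ≤ √S.card := Real.one_le_sqrt.2 (by exact_mod_cast hS.card_pos)
  obtain ⟨m, hm, hm'⟩ := exists_nat_pow_near hc (by norm_num : (1 : ℝ) < 3)
  have hodd : ∀ l : ℕ, 2 * ((3 ^ l - 1) / 2) + 1 = 3 ^ l := by
    intro l
    have : Odd (3 ^ l) := Odd.pow (by decide)
    obtain ⟨r, hr⟩ := this
    omega
  -- Run `l` has `(3 ^ l - 1) / 2` iterations, so it makes `3 ^ l` queries and `3 ^ l` is also the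
  -- multiple of the angle.
  obtain ⟨Q, hq, hQ⟩ := exists_isOneSided_prod hS.choose (fun l => grover hS ((3 ^ l - 1) / 2)) F
    (fun l x => Real.cos (3 ^ l * groverAngle S x) ^ 2) (fun l x => ⟨fun hx =>
      outputProb_grover_zero_of_forall hS _ x (h₁ x hx), fun hx => by
        have : (2 * (((3 ^ l - 1) / 2 : ℕ) : ℝ) + 1) = 3 ^ l := by exact_mod_cast hodd l
        rw [outputProb_grover_one, this]⟩) (m + 2)
  refine ⟨Q, ?_, fun x => ⟨(hQ x).1, fun hx => ((hQ x).2 hx).trans ?_⟩⟩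
  -- The geometric sum is `(3 ^ (m + 2) - 1) / 2`, and `3 ^ m ≤ √S.card`; this gives `9 / 2`.
  · have hq' : Q.queries = ∑ l ∈ Finset.range (m + 2), 3 ^ l := by
      rw [hq]; exact Finset.sum_congr rfl fun l _ => hodd l
    rw [hq']
    push_cast
    rw [geom_sum_eq (by norm_num), pow_succ, pow_succ]
    linarith
  -- With at least one zero, `θ ≥ sin θ ≥ 1 / √S.card`, so `3 ^ (m + 1) * θ ≥ 1`.
  · have hsin : √(S.filter (x · = 0)).card / √S.card ≤ groverAngle S x := by
      rw [← sin_groverAngle]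
      exact Real.sin_le (Real.arcsin_nonneg.2 (Real.sqrt_nonneg _))
    obtain ⟨i, hi, hxi⟩ := h₀ x hx
    have hg : (1 : ℝ) ≤ √(S.filter (x · = 0)).card :=
      Real.one_le_sqrt.2 (by exact_mod_cast Finset.card_pos.2 ⟨i, Finset.mem_filter.2 ⟨hi, hxi⟩⟩)
    rw [div_le_iff₀ (by linarith)] at hsin
    have hθ : 0 ≤ groverAngle S x := Real.arcsin_nonneg.2 (Real.sqrt_nonneg _)
    obtain ⟨l, hl, hl'⟩ := exists_cos_three_pow_mul_sq_le (L := m + 1) (θ := groverAngle S x)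
      (Real.arcsin_le_pi_div_two _) (by nlinarith)
    refine le_trans ?_ hl'
    beta_reduce
    rw [← Finset.mul_prod_erase _ _ (Finset.mem_range.2 (by omega : l < m + 2))]
    refine mul_le_of_le_one_right (sq_nonneg _) (Finset.prod_le_one (fun _ _ => sq_nonneg _) ?_)
    exact fun _ _ => Real.cos_sq_le_one _

lemma exists_errorProb_conjunction_le {M : ℕ} (i₀ : Fin M) (R : ℕ) {n : ℕ} (j : Fin n → Fin M) :
    ∃ Q : QueryAlgorithm M, (Q.queries : ℝ) ≤ R * (9 / 2) * √n ∧
      ∀ x, Q.errorProb (fun x => ∏ z, x (j z)) x ≤ (1 / 2) ^ R := by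
  -- Grover search needs a nonempty set, so the empty conjunction is answered by a constant.
  rcases Nat.eq_zero_or_pos n with rfl | hn
  · refine ⟨const i₀ 1, by simp [const], fun x => ?_⟩
    simp [errorProb_const]
  · have hS : (Finset.univ.image j).Nonempty := ⟨j ⟨0, hn⟩, by simp⟩
    have hone : ∀ u : ZMod 2, u ≠ 0 → u = 1 := by decide
    obtain ⟨Q, hq, hQ⟩ := exists_isOneSided_half hS (fun x => ∏ z, x (j z))
      (fun x hx i hi => by
        obtain ⟨z, -, rfl⟩ := Finset.mem_image.1 hi
        refine hone _ fun h0 => ?_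
        rw [Finset.prod_eq_zero (Finset.mem_univ z) h0] at hx
        exact absurd hx (by decide))
      (fun x hx => by
        obtain ⟨z, -, hz⟩ := Finset.prod_eq_zero_iff.1 hx
        exact ⟨j z, by simp, hz⟩)
    obtain ⟨Q', hq', hQ'⟩ := exists_isOneSided_prod i₀ (fun _ => Q) _ _ (fun _ => hQ) R
    simp only [Finset.prod_const, Finset.card_range] at hQ'
    refine ⟨Q', ?_, hQ'.errorProb_le (by positivity)⟩
    have hle : √((Finset.univ.image j).card : ℝ) ≤ √n := by
      refine Real.sqrt_le_sqrt ?_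
      have := Finset.card_image_le (s := Finset.univ) (f := j)
      rw [Finset.card_univ, Fintype.card_fin] at this
      exact_mod_cast this
    rw [hq', Finset.sum_const, Finset.card_range, nsmul_eq_mul]
    push_cast
    rw [mul_assoc]
    exact mul_le_mul_of_nonneg_left (by linarith) (Nat.cast_nonneg _)

/-- Cauchy–Schwarz; the extra `k` inside the root is slack. -/
lemma sum_sqrt_le_sqrt_mul_add {k : ℕ} (t : Fin k → ℕ) :
    ∑ i, √(t i : ℝ) ≤ √((k : ℝ) * ((k : ℝ) + ∑ i, (t i : ℝ))) := by
  refine Real.le_sqrt_of_sq_le ?_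
  have h := sq_sum_le_card_mul_sum_sq (s := Finset.univ) (f := fun i => √(t i : ℝ))
  simp only [Finset.card_univ, Fintype.card_fin, Real.sq_sqrt (Nat.cast_nonneg _)] at h
  refine h.trans (mul_le_mul_of_nonneg_left ?_ (Nat.cast_nonneg _))
  linarith [(Nat.cast_nonneg k : (0 : ℝ) ≤ k)]

theorem corollary1 :
    ∃ C₁ C₂ : ℝ, 0 < C₁ ∧ 0 < C₂ ∧
      ∀ (M : ℕ), 1 ≤ M → ∀ (k : ℕ), 2 ≤ k →
      ∀ (a : ZMod 2) (t : Fin k → ℕ) (j : (i : Fin k) → Fin (t i) → Fin M)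
        (F : (Fin M → ZMod 2) → ZMod 2), (∀ x, F x = zhegalkin a t j x) →
        ∃ Q : QueryAlgorithm M,
          (Q.queries : ℝ) ≤
            C₁ * (Real.sqrt ((k : ℝ) * ((k : ℝ) + ∑ i : Fin k, (t i : ℝ))) * Real.log (k : ℝ)) ∧
          ∀ x : Fin M → ZMod 2, Q.errorProb F x ≤ C₂ * (1 / (k : ℝ)) := by
  have hlog2 : 0 < Real.log 2 := Real.log_pos (by norm_num)
  refine ⟨18 / Real.log 2, 1, by positivity, one_pos, ?_⟩
  intro M hM k hk a t j F hF
  obtain rfl : F = fun x => a + ∑ i, ∏ z, x (j i z) := funext hF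
  have hk2 : (2 : ℝ) ≤ k := by exact_mod_cast hk
  -- With `2 ^ m ≤ k < 2 ^ (m + 1)`, using `2 * (m + 1)` repetitions makes each conjunction's error
  -- `4⁻¹ ^ (m + 1) < 1 / k²`.
  obtain ⟨m, hm, hm'⟩ := exists_nat_pow_near (by linarith : (1 : ℝ) ≤ k) (one_lt_two (α := ℝ))
  obtain ⟨Q, hq, hQ⟩ := exists_errorProb_add_sum_le (⟨0, hM⟩ : Fin M) a
    (fun i x => ∏ z, x (j i z)) _ _
    (fun i => exists_errorProb_conjunction_le ⟨0, hM⟩ (2 * (m + 1)) (j i)) Finset.univ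
  refine ⟨Q, hq.trans ?_, fun x => (hQ x).trans ?_⟩
  · have hmlog : m * Real.log 2 ≤ Real.log k := by
      rw [← Real.log_pow]
      exact Real.log_le_log (by positivity) hm
    have hklog : Real.log 2 ≤ Real.log k := Real.log_le_log (by norm_num) hk2
    -- Both `m` and `1` are at most `log k / log 2`, so `9 * (m + 1)` is at most `18 * log k / log
    -- 2`.
    have hR : ((2 * (m + 1) : ℕ) : ℝ) * (9 / 2) ≤ 18 / Real.log 2 * Real.log k := by
      rw [div_mul_eq_mul_div, le_div_iff₀ hlog2]
      push_cast
      nlinarith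
    rw [← Finset.mul_sum, mul_comm (√_), ← mul_assoc]
    exact mul_le_mul hR (sum_sqrt_le_sqrt_mul_add t)
      (Finset.sum_nonneg fun _ _ => Real.sqrt_nonneg _) ((by positivity : (0 : ℝ) ≤ _).trans hR)
  · have hk0 : (0 : ℝ) < k := by linarith
    rw [Finset.card_univ, Fintype.card_fin, one_mul, one_div_pow, mul_comm 2, pow_mul,
      mul_one_div, div_le_div_iff₀ (by positivity) hk0]
    nlinarith
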